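/- Let $\mathbb F$ be the category of finite sets and maps. A subcategory $\mathrm{Ctx}\hookrightarrow\mathbb F$ is \emph{contextual} if it contains all objects, if $f,g\in\mathrm{Ctx}$ implies $f+g\in\mathrm{Ctx}$ (where $+$ is the disjoint sum), and if for every pullback square of finite sets with sides $r_f\colon f^*B\to B$, $f^*B\to X$, $b\colon B\to Y$ and $f\colon X\to Y$, $f\in\mathrm{Ctx}$ implies $r_f\in\mathrm{Ctx}$. Let $\mathrm{PSh}(\mathrm{Ctx})$ be the category of functors $\mathrm{Ctx}\to\mathrm{Set}$ and natural transformations. For $A\in\mathrm{Ctx}$ and $Y\in\mathrm{PSh}(\mathrm{Ctx})$ let $$A\triangleleft Y=\int^{(B_a)_{a\in A}}\mathrm{Ctx}\Big(\sum_{a\in A}B_a,-\Big)\times\prod_{a\in A}Y B_a$$ be the $A$-fold Day convolution of $Y$ with respect to $+$, where the coend is over families of objects $B_a$ and families of morphisms of $\mathrm{Ctx}$. Write $[f,(t_a)_a]$ for the element of $(A\triangleleft Y)C$ represented by $f\colon\sum_aB_a\to C$ in $\mathrm{Ctx}$ and $t_a\in YB_a$. A morphism $j\colon A\to A'$ of $\mathrm{Ctx}$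 acts by $A'\triangleleft Y\to A\triangleleft Y$, $[f,(t_{a'})_{a'}]\mapsto[f\cdot r_j,(t_{j(a)})_a]$, where $r_j\colon\sum_aB_{j(a)}\to\sum_{a'}B_{a'}$ is the reindexing map; this makes $\triangleleft$ a bifunctor $\mathrm{Ctx}^{\mathrm{op}}\times\mathrm{PSh}(\mathrm{Ctx})\to\mathrm{PSh}(\mathrm{Ctx})$. The \emph{substitution tensor} is the bifunctor $$X\diamond Y=\int^{A\in\mathrm{Ctx}}XA\times(A\triangleleft Y).$$ Let $V=\mathrm{Ctx}(1,-)$, and $(Y\multimap Z)A=\mathrm{Nat}(A\triangleleft Y,Z)$. Theorem. The subcategories $\mathbb F$, $\mathbb I$, $\mathbb S$, $\mathbb B$ of $\mathbb F$ with all objects and with all maps, injections, surjections and bijections, respectively, are contextual. For every contextual subcategory $\mathrm{Ctx}\hookrightarrow\mathbb F$, $(\mathrm{PSh}(\mathrm{Ctx}),\diamond,V)$ is a right-closed monoidal category with internal hom $Y\multimap Z$. That is, there are natural isomorphisms $$\alpha\colon(X\diamond Y)\diamond Z\cong X\diamond(Y\diamond Z),\qquad\lambda\colon V\diamond X\cong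 X,\qquad\rho\colon X\diamond V\cong X$$ that satisfy the axioms of a monoidal category and are given on representatives by $$\alpha\big[[x,[f,(y_a)_a]],[g,(z_c)_c]\big]=\big[x,[h,([y_a,[\mathrm{id},(z_{f(a,b)})_{b}]])_a]\big],\quad h(a,b,d)=g(f(a,b),d),$$ $$\lambda[v,[f,(t_a)_a]]=f(v(*),-)\cdot t_{v(*)},\qquad\rho[x,[f,(v_a)_a]]=\big(a\mapsto f(a,v_a(*))\big)\cdot x$$ (where $k\cdot x$ denotes the action of a morphism $k$ of $\mathrm{Ctx}$ on $x$); and for every $Y$ the functor $(-)\diamond Y$ is left adjoint to $Y\multimap(-)$, where $\varphi\colon X\diamond Y\to Z$ corresponds to the map $X\to(Y\multimap Z)$ that sends $x\in XA$ to $\gamma\mapsto\varphi[x,\gamma]$. -/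

import Mathlib

open CategoryTheory Opposite

universe u

/-- A subcategory `Ctx ↪ 𝔽` of the category `𝔽` of finite sets that contains all objects is given by
a class `P` of maps that contains the identities and is closed under composition.
It is *contextual* if it is closed under the sum `f + g` of maps and pullback-stable:
for every pullback square of finite sets with sides `r_f : f^*B → B`, `f^*B → X`, `b : B → Y`
and `f : X → Y`, if `f` is in `P` then the map `r_f` opposite to `f` is in `P`
(this is the field `of_isPullback` of `IsStableUnderBaseChange`). -/
class IsContextual (P : MorphismProperty FintypeCat.{0}) : Prop extends
    P.IsMultiplicative, P.IsStableUnderBaseChange where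
  sum_mem : ∀ {A A' B B' : FintypeCat.{0}} (f : A ⟶ A') (g : B ⟶ B'), P f → P g →
    P (FintypeCat.homMk (Sum.map f g) : FintypeCat.of (A ⊕ B) ⟶ FintypeCat.of (A' ⊕ B'))

/-- The category `Ctx` of all finite sets with the maps in `P`. -/
abbrev Ctx (P : MorphismProperty FintypeCat.{0}) [IsContextual P] : Type 1 :=
  WideSubcategory P

/-- Covariant presheaves `Ctx ⥤ Set`. The universe `Type (u + 1)` of sets is one
for which `Ctx` is small. -/
abbrev PSh (P : MorphismProperty FintypeCat.{0}) [IsContextual P] : Type (u + 2) :=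
  Ctx P ⥤ Type (u + 1)

namespace Ctx

variable {P : MorphismProperty FintypeCat.{0}} [IsContextual P]

instance : CoeSort (Ctx P) Type := ⟨fun A => A.obj.obj⟩

instance (A : Ctx P) : Finite A := A.obj.property

/-- A finite set as an object of `Ctx`. -/
def of (P : MorphismProperty FintypeCat.{0}) [IsContextual P] (T : Type) [Finite T] : Ctx P :=
  ⟨FintypeCat.of T⟩

/-- The underlying map of a morphism of `Ctx`. -/
def fn {A B : Ctx P} (f : A ⟶ B) : A → B := fun a => f.hom a

/-- A map in `P` as a morphism of `Ctx`. -/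
def homMk {A B : Ctx P} (f : A → B)
    (hf : P (FintypeCat.homMk f : A.obj ⟶ B.obj)) : A ⟶ B := ⟨FintypeCat.homMk f, hf⟩

@[simp] theorem fn_homMk {A B : Ctx P} (f : A → B) (hf) : fn (homMk (P := P) f hf) = f := rfl

@[simp] theorem fn_id (A : Ctx P) (a : A) : fn (𝟙 A) a = a := rfl

@[simp] theorem fn_comp {A B C : Ctx P} (f : A ⟶ B) (g : B ⟶ C) (a : A) :
    fn (f ≫ g) a = fn g (fn f a) := rfl

theorem hom_ext {A B : Ctx P} {f g : A ⟶ B} (h : ∀ a, fn f a = fn g a) : f = g :=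
  WideSubcategory.hom_ext (P := P) (FintypeCat.hom_ext _ _ h)

end Ctx

namespace IsContextual

variable {P : MorphismProperty FintypeCat.{0}} [IsContextual P]

theorem equiv_mem {A B : Type} [Finite A] [Finite B] (e : A ≃ B) :
    P (FintypeCat.homMk e : FintypeCat.of A ⟶ FintypeCat.of B) := by
  have h : IsIso (FintypeCat.homMk e : FintypeCat.of A ⟶ FintypeCat.of B) :=
    (FintypeCat.equivEquivIso (A := FintypeCat.of A) (B := FintypeCat.of B) e).isIso_hom
  exact P.of_isIso _

theorem mem_of_equiv {A A' B B' : Type} [Finite A] [Finite A'] [Finite B] [Finite B']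
    (f : A → B) (hf : P (FintypeCat.homMk f : FintypeCat.of A ⟶ FintypeCat.of B))
    (e : A' ≃ A) (e' : B ≃ B') (f' : A' → B') (h : ∀ a, f' a = e' (f (e a))) :
    P (FintypeCat.homMk f' : FintypeCat.of A' ⟶ FintypeCat.of B') := by
  have : (FintypeCat.homMk f' : FintypeCat.of A' ⟶ FintypeCat.of B') =
      (FintypeCat.homMk e : FintypeCat.of A' ⟶ FintypeCat.of A) ≫
      (FintypeCat.homMk f : FintypeCat.of A ⟶ FintypeCat.of B) ≫
      (FintypeCat.homMk e' : FintypeCat.of B ⟶ FintypeCat.of B') :=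
    FintypeCat.hom_ext _ _ h
  rw [this]
  exact P.comp_mem _ _ (equiv_mem e) (P.comp_mem _ _ hf (equiv_mem e'))

/-- `P` is closed under sums of finite families of maps. -/
theorem sigma_mem (A : Type) [Finite A] : ∀ (B B' : A → Type) [∀ a, Finite (B a)]
    [∀ a, Finite (B' a)] (j : ∀ a, B a → B' a),
    (∀ a, P (FintypeCat.homMk (j a) : FintypeCat.of (B a) ⟶ FintypeCat.of (B' a))) →
    P (FintypeCat.homMk (Sigma.map id j) :
      FintypeCat.of (Σ a, B a) ⟶ FintypeCat.of (Σ a, B' a)) := by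
  suffices H : ∀ [Finite A], ∀ (B B' : A → Type) [∀ a, Finite (B a)]
    [∀ a, Finite (B' a)] (j : ∀ a, B a → B' a),
    (∀ a, P (FintypeCat.homMk (j a) : FintypeCat.of (B a) ⟶ FintypeCat.of (B' a))) →
    P (FintypeCat.homMk (Sigma.map id j) :
      FintypeCat.of (Σ a, B a) ⟶ FintypeCat.of (Σ a, B' a)) from H
  induction A using Finite.induction_empty_option with
  | of_equiv e ih =>
    rename_i α β
    intro _ B B' _ _ j hj
    have : Finite α := Finite.of_equiv _ e.symm
    refine mem_of_equiv _ (ih (fun a => B (e a)) (fun a => B' (e a)) (fun a => j (e a))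
      (fun a => hj (e a))) (Equiv.sigmaCongrLeft (β := B) e).symm
      (Equiv.sigmaCongrLeft (β := B') e) _ ?_
    intro x
    obtain ⟨y, rfl⟩ := (Equiv.sigmaCongrLeft (β := B) e).surjective x
    rw [Equiv.symm_apply_apply]
    rfl
  | h_empty =>
    intro _ B B' _ _ j hj
    exact mem_of_equiv (id : PEmpty → PEmpty) (P.id_mem _)
      (Equiv.equivOfIsEmpty _ _) (Equiv.equivOfIsEmpty _ _) _ (fun x => x.1.elim)
  | h_option ih =>
    rename_i α _
    intro _ B B' _ _ j hj
    have key : ∀ C : Option α → Type, ∃ e : (Σ a, C a) ≃ C none ⊕ Σ a, C (some a),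
        (∀ x, e ⟨none, x⟩ = Sum.inl x) ∧ ∀ a x, e ⟨some a, x⟩ = Sum.inr ⟨a, x⟩ := fun C =>
      ⟨{ toFun := fun x => match x with
            | ⟨none, x⟩ => Sum.inl x
            | ⟨some a, x⟩ => Sum.inr ⟨a, x⟩
         invFun := fun x => match x with
            | Sum.inl x => ⟨none, x⟩
            | Sum.inr ⟨a, x⟩ => ⟨some a, x⟩
         left_inv := by rintro ⟨_ | _, _⟩ <;> rfl
         right_inv := by rintro (_ | _) <;> rfl }, fun _ => rfl, fun _ _ => rfl⟩
    obtain ⟨e, he, he'⟩ := key B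
    obtain ⟨d, hd, hd'⟩ := key B'
    refine mem_of_equiv _ (sum_mem (P := P)
      (FintypeCat.homMk (j none) : FintypeCat.of (B none) ⟶ FintypeCat.of (B' none))
      _ (hj none) (ih (fun a => B (some a)) (fun a => B' (some a)) (fun a => j (some a))
      (fun a => hj (some a)))) e d.symm _ ?_
    rintro ⟨_ | a, x⟩
    · rw [Equiv.eq_symm_apply, he]
      exact hd _
    · rw [Equiv.eq_symm_apply, he']
      exact hd' _ _

/-- For a family `B` of finite sets over `A'` and `f : A → A'` in `P`, the reindexing map
`f^*B = ∑ a, B (f a) → ∑ a', B a'` is in `P`. -/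
theorem reindex_mem {A A' : Type} [Finite A] [Finite A'] (f : A → A')
    (hf : P (FintypeCat.homMk f : FintypeCat.of A ⟶ FintypeCat.of A'))
    (B : A' → Type) [∀ a, Finite (B a)] :
    P (FintypeCat.homMk (fun x => ⟨f x.1, x.2⟩) :
      FintypeCat.of (Σ a, B (f a)) ⟶ FintypeCat.of (Σ a, B a)) := by
  refine MorphismProperty.of_isPullback (P := P)
    (f' := (FintypeCat.homMk Sigma.fst : FintypeCat.of (Σ a, B (f a)) ⟶ FintypeCat.of A))
    (f := (FintypeCat.homMk Sigma.fst : FintypeCat.of (Σ a, B a) ⟶ FintypeCat.of A')) ?_ hf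
  have w : ∀ {Z : FintypeCat.{0}} (p : Z ⟶ FintypeCat.of A)
      (q : Z ⟶ FintypeCat.of (Σ a, B a)),
      p ≫ (FintypeCat.homMk f : FintypeCat.of A ⟶ FintypeCat.of A') =
        q ≫ (FintypeCat.homMk Sigma.fst : FintypeCat.of (Σ a, B a) ⟶ FintypeCat.of A') →
      ∀ z, (q z).1 = f (p z) :=
    fun p q h z => (ConcreteCategory.congr_hom h z).symm
  refine ⟨⟨rfl⟩, ⟨Limits.PullbackCone.IsLimit.mk _
    (fun s => FintypeCat.homMk fun z => ⟨s.fst z, (w _ _ s.condition z) ▸ (s.snd z).2⟩)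
    (fun s => rfl) (fun s => ?_) (fun s m h₁ h₂ => ?_)⟩⟩
  · refine FintypeCat.hom_ext _ _ fun z => ?_
    exact Sigma.ext (w _ _ s.condition z).symm (by
      change HEq ((w _ _ s.condition z) ▸ (s.snd z).2) _
      simp)
  · refine FintypeCat.hom_ext _ _ fun z => ?_
    have e₁ : (m z).1 = s.fst z := ConcreteCategory.congr_hom h₁ z
    have e₂ : (⟨f (m z).1, (m z).2⟩ : Σ a, B a) = s.snd z := ConcreteCategory.congr_hom h₂ z
    refine Sigma.ext e₁ ?_
    change HEq (m z).2 ((w _ _ s.condition z) ▸ (s.snd z).2)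
    refine HEq.trans ?_ (by simp : HEq (s.snd z).2 _)
    exact (Sigma.ext_iff.1 e₂).2

end IsContextual

section Substitution

variable {P : MorphismProperty FintypeCat.{0}} [IsContextual P]

namespace Ctx

/-- The sum `∑ a, B a` of a family of contexts. -/
def sigma {A : Ctx P} (B : A → Ctx P) : Ctx P := of P (Σ a, B a)

/-- The sum `∑ a, B a → ∑ a, B' a` of a family of morphisms. -/
def sigmaMap {A : Ctx P} {B B' : A → Ctx P} (j : ∀ a, B a ⟶ B' a) : sigma B ⟶ sigma B' :=
  homMk (Sigma.map id fun a => fn (j a))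
    (IsContextual.sigma_mem A (fun a => B a) (fun a => B' a) _ fun a => (j a).property)

/-- The reindexing map `r_f : f^*B = ∑ a, B (f a) → ∑ a', B a'` of `f : A ⟶ A'`. -/
def reindex {A A' : Ctx P} (f : A ⟶ A') (B : A' → Ctx P) :
    sigma (fun a => B (fn f a)) ⟶ sigma B :=
  homMk (fun x => ⟨fn f x.1, x.2⟩) (IsContextual.reindex_mem (fn f) f.property (fun a => B a))

end Ctx

/-- Representatives of the elements of `(A ◁ X) C`. -/
structure SubstPre (A : Ctx P) (X : PSh.{u} P) (C : Ctx P) : Type (u + 1) where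
  fam : A → Ctx P
  ren : Ctx.sigma fam ⟶ C
  term : ∀ a, X.obj (fam a)

/-- The relation generating the equality of elements of `(A ◁ X) C`:
`(f ∘ ∑ a, j a, t) ~ (f, (j a · t a)_a)` for every family `j a : B a ⟶ B' a`. -/
inductive SubstRel (A : Ctx P) (X : PSh.{u} P) (C : Ctx P) :
    SubstPre A X C → SubstPre A X C → Prop
  | mk {B B' : A → Ctx P} (j : ∀ a, B a ⟶ B' a) (f : Ctx.sigma B' ⟶ C)
      (t : ∀ a, X.obj (B a)) :
      SubstRel A X C ⟨B, Ctx.sigmaMap j ≫ f, t⟩ ⟨B', f, fun a => X.map (j a) (t a)⟩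

/-- The set `(A ◁ X) C`, that is, the coend `∫^{(B a)_a} Ctx(∑ a, B a, C) × ∏ a, X (B a)`
over the category `Ctx^A` of `A`-indexed families of contexts. -/
def Subst (A : Ctx P) (X : PSh.{u} P) (C : Ctx P) : Type (u + 1) := Quot (SubstRel A X C)

namespace Subst

/-- The element `[f, (t a)_a]` of `(A ◁ X) C`. -/
def mk {A : Ctx P} {X : PSh.{u} P} {C : Ctx P} {B : A → Ctx P} (f : Ctx.sigma B ⟶ C)
    (t : ∀ a, X.obj (B a)) : Subst A X C := Quot.mk _ ⟨B, f, t⟩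

theorem mk_eq {A : Ctx P} {X : PSh.{u} P} {C : Ctx P} {B B' : A → Ctx P}
    (j : ∀ a, B a ⟶ B' a) (f : Ctx.sigma B' ⟶ C) (t : ∀ a, X.obj (B a)) :
    mk (X := X) (Ctx.sigmaMap j ≫ f) t = mk f fun a => X.map (j a) (t a) :=
  Quot.sound (.mk j f t)

theorem ind {A : Ctx P} {X : PSh.{u} P} {C : Ctx P} {p : Subst A X C → Prop}
    (h : ∀ (B : A → Ctx P) (f : Ctx.sigma B ⟶ C) (t : ∀ a, X.obj (B a)), p (mk f t))
    (σ : Subst A X C) : p σ := by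
  obtain ⟨⟨B, f, t⟩⟩ := σ
  exact h B f t

/-- `g · [f, t] = [g ∘ f, t]`. -/
def post {A : Ctx P} {X : PSh.{u} P} {C D : Ctx P} (g : C ⟶ D) : Subst A X C → Subst A X D :=
  Quot.lift (fun s => mk (s.ren ≫ g) s.term) (by
    rintro _ _ ⟨j, f, t⟩
    simpa only [Category.assoc] using mk_eq j (f ≫ g) t)

/-- A natural transformation `X ⟶ Y` acts by `[f, t] ↦ [f, (φ (t a))_a]`. -/
def mapTerm {A : Ctx P} {X Y : PSh.{u} P} (φ : X ⟶ Y) {C : Ctx P} : Subst A X C → Subst A Y C :=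
  Quot.lift (fun s => mk s.ren fun a => φ.app _ (s.term a)) (by
    rintro _ _ ⟨j, f, t⟩
    simpa only [NatTrans.naturality_apply] using mk_eq (X := Y) j f fun a => φ.app _ (t a))

/-- `i : A ⟶ A'` acts by `[f, t] · i = [f ∘ r_i, (t (i a))_a]`. -/
def pre {A A' : Ctx P} (i : A ⟶ A') {X : PSh.{u} P} {C : Ctx P} : Subst A' X C → Subst A X C :=
  Quot.lift (fun s => mk (Ctx.reindex i s.fam ≫ s.ren) fun a => s.term (Ctx.fn i a)) (by
    rintro _ _ ⟨j, f, t⟩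
    exact mk_eq (X := X) (fun a => j (Ctx.fn i a)) (Ctx.reindex i _ ≫ f)
      fun a => t (Ctx.fn i a))

end Subst

/-- The bifunctor `(A, X) ↦ A ◁ X`; the presheaf `A ◁ X` is the `A`-fold Day convolution of `X`
with respect to the sum of contexts. -/
def substAction (P : MorphismProperty FintypeCat.{0}) [IsContextual P] :
    (Ctx P)ᵒᵖ ⥤ PSh.{u} P ⥤ PSh.{u} P where
  obj A :=
    { obj X :=
        { obj C := Subst A.unop X C
          map g := ↾(Subst.post g)
          map_id C := by
            ext σ
            induction σ using Subst.ind with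
            | h B f t => exact congrArg (fun f => Subst.mk f t) (Category.comp_id f)
          map_comp g h := by
            ext σ
            induction σ using Subst.ind with
            | h B f t => exact congrArg (fun f => Subst.mk f t) (Category.assoc f g h).symm }
      map φ :=
        { app C := ↾(Subst.mapTerm φ)
          naturality C D g := by
            ext σ
            induction σ using Subst.ind with
            | h B f t => rfl }
      map_id X := by
        ext C σ
        induction σ using Subst.ind with
        | h B f t => rfl
      map_comp φ ψ := by
        ext C σ
        induction σ using Subst.ind with
        | h B f t => rfl }
  map i :=
    { app X :=
        { app C := ↾(Subst.pre i.unop)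
          naturality C D g := by
            ext σ
            induction σ using Subst.ind with
            | h B f t => rfl }
      naturality X Y φ := by
        ext C σ
        induction σ using Subst.ind with
        | h B f t => rfl }
  map_id A := by
    ext X C σ
    induction σ using Subst.ind with
    | h B f t => rfl
  map_comp i j := by
    ext X C σ
    induction σ using Subst.ind with
    | h B f t => rfl

/-- The substitution presheaf `A ◁ X`. -/
abbrev substPSh (A : Ctx P) (X : PSh.{u} P) : PSh.{u} P := ((substAction P).obj (op A)).obj X

/-- Representatives of the elements of `(X ⋄ Y) C`. -/
structure TensorPre (X Y : PSh.{u} P) (C : Ctx P) : Type (u + 1) where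
  ctx : Ctx P
  term : X.obj ctx
  subst : (substPSh ctx Y).obj C

/-- The relation generating the equality of elements of `(X ⋄ Y) C`:
`(j · x, γ) ~ (x, γ · j)` for every `j : A ⟶ A'`. -/
inductive TensorRel (X Y : PSh.{u} P) (C : Ctx P) : TensorPre X Y C → TensorPre X Y C → Prop
  | mk {A A' : Ctx P} (j : A ⟶ A') (x : X.obj A)
      (γ : (substPSh A' Y).obj C) :
      TensorRel X Y C ⟨A', X.map j x, γ⟩ ⟨A, x, (((substAction P).map j.op).app Y).app C γ⟩

/-- The set `(X ⋄ Y) C`, that is, the coend `∫^A X A × (A ◁ Y) C` over `A` in `Ctx`. -/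
def Tensor (X Y : PSh.{u} P) (C : Ctx P) : Type (u + 1) := Quot (TensorRel X Y C)

namespace Tensor

/-- The element `[x, γ]` of `(X ⋄ Y) C`. -/
def mk {X Y : PSh.{u} P} {C A : Ctx P} (x : X.obj A)
    (γ : (substPSh A Y).obj C) : Tensor X Y C := Quot.mk _ ⟨A, x, γ⟩

theorem mk_eq {X Y : PSh.{u} P} {C A A' : Ctx P} (j : A ⟶ A') (x : X.obj A)
    (γ : (substPSh A' Y).obj C) :
    mk (X.map j x) γ = mk x ((((substAction P).map j.op).app Y).app C γ) :=
  Quot.sound (.mk j x γ)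

theorem ind {X Y : PSh.{u} P} {C : Ctx P} {p : Tensor X Y C → Prop}
    (h : ∀ (A : Ctx P) (x : X.obj A) (γ : (substPSh A Y).obj C),
      p (mk x γ)) (s : Tensor X Y C) : p s := by
  obtain ⟨⟨A, x, γ⟩⟩ := s
  exact h A x γ

/-- `g · [x, γ] = [x, g · γ]`. -/
def post {X Y : PSh.{u} P} {C D : Ctx P} (g : C ⟶ D) : Tensor X Y C → Tensor X Y D :=
  Quot.lift (fun s => mk s.term ((substPSh s.ctx Y).map g s.subst)) (by
    rintro _ _ ⟨j, x, γ⟩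
    simpa only [NatTrans.naturality_apply] using
      mk_eq (Y := Y) j x ((substPSh _ Y).map g γ))

/-- `φ : X ⟶ X'` and `ψ : Y ⟶ Y'` act by `[x, γ] ↦ [φ x, (A ◁ ψ) γ]`. -/
def map {X X' Y Y' : PSh.{u} P} (φ : X ⟶ X') (ψ : Y ⟶ Y') {C : Ctx P} :
    Tensor X Y C → Tensor X' Y' C :=
  Quot.lift (fun s => mk (φ.app _ s.term)
      ((((substAction P).obj (op s.ctx)).map ψ).app C s.subst)) (by
    rintro _ _ ⟨j, x, γ⟩
    have h := mk_eq (Y := Y') j (φ.app _ x) ((((substAction P).obj (op _)).map ψ).app C γ)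
    rw [← NatTrans.naturality_apply] at h
    refine h.trans (congrArg (mk (φ.app _ x)) ?_)
    induction γ using Subst.ind with
    | h B f t => rfl)

end Tensor

/-- The substitution tensor as a bifunctor `(X, Y) ↦ X ⋄ Y`. -/
def substTensor (P : MorphismProperty FintypeCat.{0}) [IsContextual P] :
    PSh.{u} P ⥤ PSh.{u} P ⥤ PSh.{u} P where
  obj X :=
    { obj Y :=
        { obj C := Tensor X Y C
          map g := ↾(Tensor.post g)
          map_id C := by
            ext s
            induction s using Tensor.ind with
            | h A x γ =>
              exact congrArg (Tensor.mk x) (Functor.map_id_apply (substPSh A Y) C γ)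
          map_comp g h := by
            ext s
            induction s using Tensor.ind with
            | h A x γ =>
              exact congrArg (Tensor.mk x) (Functor.map_comp_apply (substPSh A Y) g h γ) }
      map ψ :=
        { app C := ↾(Tensor.map (𝟙 X) ψ)
          naturality C D g := by
            ext s
            induction s using Tensor.ind with
            | h A x γ =>
              exact congrArg (Tensor.mk x) (NatTrans.naturality_apply
                (((substAction P).obj (op A)).map ψ) g γ) }
      map_id Y := by
        ext C s
        induction s using Tensor.ind with
        | h A x γ =>
          exact congrArg (Tensor.mk x) (by rw [CategoryTheory.Functor.map_id]; rfl)
      map_comp ψ ψ' := by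
        ext C s
        induction s using Tensor.ind with
        | h A x γ =>
          exact congrArg (Tensor.mk x) (by rw [CategoryTheory.Functor.map_comp]; rfl) }
  map φ :=
    { app Y :=
        { app C := ↾(Tensor.map φ (𝟙 Y))
          naturality C D g := by
            ext s
            induction s using Tensor.ind with
            | h A x γ =>
              exact congrArg (Tensor.mk (φ.app _ x)) (NatTrans.naturality_apply
                (((substAction P).obj (op A)).map (𝟙 Y)) g γ) }
      naturality Y Y' ψ := by
        ext C s
        induction s using Tensor.ind with
        | h A x γ =>
          induction γ using Subst.ind with
          | h B f t => rfl }
  map_id X := by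
    ext Y C s
    induction s using Tensor.ind with
    | h A x γ =>
      induction γ using Subst.ind with
      | h B f t => rfl
  map_comp φ φ' := by
    ext Y C s
    induction s using Tensor.ind with
    | h A x γ =>
      induction γ using Subst.ind with
      | h B f t => rfl

/-- The substitution tensor `X ⋄ Y` on objects. -/
abbrev tensorPSh (X Y : PSh.{u} P) : PSh.{u} P := ((substTensor P).obj X).obj Y

infixl:70 " ⋄ " => tensorPSh

/-- The presheaf of variables `V = Ctx(1, -)`. -/
def substUnit (P : MorphismProperty FintypeCat.{0}) [IsContextual P] : PSh.{u} P :=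
  coyoneda.obj (op (Ctx.of P PUnit)) ⋙ uliftFunctor.{u + 1}

/-- A morphism `v : 1 ⟶ A` as an element of `V A`. -/
def substUnit.var {A : Ctx P} (v : Ctx.of P PUnit ⟶ A) : (substUnit P).obj A := ULift.up v

/-- The internal hom `Z ↦ (Y ⊸ Z)`, where `(Y ⊸ Z) A` is the set of natural
transformations from `A ◁ Y` to `Z`. -/
def substHom (Y : PSh.{u} P) : PSh.{u} P ⥤ PSh.{u} P where
  obj Z :=
    { obj A := substPSh A Y ⟶ Z
      map j := ↾(fun θ => ((substAction P).map j.op).app Y ≫ θ) }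
  map ζ := { app A := ↾(fun θ => θ ≫ ζ) }

/-- The candidate monoidal structure with tensor `⋄` and unit `V`, for given components of the
associator and of the unitors. -/
@[reducible]
def substMonoidalStruct
    (α : ∀ X Y Z : PSh.{u} P, (X ⋄ Y) ⋄ Z ≅ X ⋄ (Y ⋄ Z))
    (lam : ∀ X : PSh.{u} P, substUnit P ⋄ X ≅ X)
    (rho : ∀ X : PSh.{u} P, X ⋄ substUnit P ≅ X) :
    MonoidalCategoryStruct (PSh.{u} P) where
  tensorObj X Y := X ⋄ Y
  whiskerLeft X _ _ ψ := ((substTensor P).obj X).map ψ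
  whiskerRight φ Y := ((substTensor P).map φ).app Y
  tensorUnit := substUnit P
  associator := α
  leftUnitor := lam
  rightUnitor := rho

end Substitution

/-! ### The four standard examples of contextual subcategories. -/

section Contextual

/-! Every element of `X ⋄ Y` has a representative `[x, [f, t]]`, and representatives are identified
by two kinds of moves: the outer coend relation along `j : A ⟶ A'` (`el_map`) and the inner one
along a family `j a` (`el_sigmaMap`). Maps out of `X ⋄ Y` are functions of representatives that
respect both moves (`Cocone.desc`), and equalities of such maps are checked on representatives.
Contextuality puts the maps needed for this into `Ctx`: pullback stability gives the reindexing
maps, closure under sums gives the sums of families.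

The unitors and the forward associator are explicit formulas. The difficulty is the inverse
associator: its input contains a finite family `t a` of elements of `Y ⋄ Z`, each known only up to a
chain of moves. Representatives are chosen for all `a` at once, and the result must not depend on
the choice. This is the principle that finite products commute with reflexive quotients
(`eq_of_forall_eqvGen`): since trivial moves are allowed, the coordinates can be changed one at a
time. It then suffices to treat moves of the same kind made in all coordinates together, and these
become moves over the sum of the contexts (`associatorInvRep_congr`).

In the monoidal axioms the two sides agree on representatives outright, by naturality, or after a
few moves. The adjunction is the universal property of the outer coend. -/

theorem FintypeCat.IsPullback.exists_lift {X Y Z W : FintypeCat.{0}} {fst : W ⟶ X} {snd : W ⟶ Y}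
    {f : X ⟶ Z} {g : Y ⟶ Z} (sq : IsPullback fst snd f g) (x : X) (y : Y) (h : f x = g y) :
    ∃ w, fst w = x ∧ snd w = y := by
  let p : FintypeCat.of PUnit ⟶ X := FintypeCat.homMk fun _ => x
  let q : FintypeCat.of PUnit ⟶ Y := FintypeCat.homMk fun _ => y
  have hpq : p ≫ f = q ≫ g := FintypeCat.hom_ext _ _ fun _ => h
  exact ⟨sq.lift p q hpq PUnit.unit, ConcreteCategory.congr_hom (sq.lift_fst p q hpq) PUnit.unit,
    ConcreteCategory.congr_hom (sq.lift_snd p q hpq) PUnit.unit⟩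

theorem FintypeCat.IsPullback.ext_elem {X Y Z W : FintypeCat.{0}} {fst : W ⟶ X} {snd : W ⟶ Y}
    {f : X ⟶ Z} {g : Y ⟶ Z} (sq : IsPullback fst snd f g) (w w' : W) (h₁ : fst w = fst w')
    (h₂ : snd w = snd w') : w = w' := by
  let p : FintypeCat.of PUnit ⟶ W := FintypeCat.homMk fun _ => w
  let q : FintypeCat.of PUnit ⟶ W := FintypeCat.homMk fun _ => w'
  have hpq : p = q := sq.hom_ext (FintypeCat.hom_ext _ _ fun _ => h₁)
    (FintypeCat.hom_ext _ _ fun _ => h₂)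
  exact ConcreteCategory.congr_hom hpq PUnit.unit

theorem IsContextual.top : IsContextual ⊤ where
  sum_mem _ _ _ _ := trivial

theorem IsContextual.injective : IsContextual (MorphismProperty.injective FintypeCat.{0}) where
  -- The square commutes, so the first projections of `w` and `w'` have equal images under an
  -- injective map.
  of_isPullback sq hg w w' h := FintypeCat.IsPullback.ext_elem sq w w' (hg (by
    have e := fun w => ConcreteCategory.congr_hom sq.w w
    simp only [ConcreteCategory.comp_apply] at e
    exact (e w).trans ((congrArg _ h).trans (e w').symm))) h
  sum_mem _ _ hf hg := Function.Injective.sumMap hf hg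

theorem IsContextual.surjective : IsContextual (MorphismProperty.surjective FintypeCat.{0}) where
  of_isPullback {_ _ _ _ f _ _ _} sq hg x := by
    obtain ⟨y, hy⟩ := hg (f x)
    obtain ⟨w, -, hw⟩ := FintypeCat.IsPullback.exists_lift sq y x hy
    exact ⟨w, hw⟩
  sum_mem _ _ hf hg := Function.Surjective.sumMap hf hg

theorem IsContextual.bijective : IsContextual (MorphismProperty.bijective FintypeCat.{0}) where
  of_isPullback sq hg := ⟨IsContextual.injective.of_isPullback sq hg.1,
    IsContextual.surjective.of_isPullback sq hg.2⟩
  sum_mem _ _ hf hg := ⟨IsContextual.injective.sum_mem _ _ hf.1 hg.1,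
    IsContextual.surjective.sum_mem _ _ hf.2 hg.2⟩

end Contextual

/-! ### Calculus of representatives in `X ⋄ Y`. -/

section Substitution

variable {P : MorphismProperty FintypeCat.{0}} [IsContextual P]

namespace Ctx

/-- A bijection as a morphism of contexts. -/
def ofEquiv {A B : Ctx P} (e : A ≃ B) : A ⟶ B := homMk e (IsContextual.equiv_mem e)

/-- The restriction `f (v *, -) : B (v *) ⟶ C` of `f : ∑ a, B a ⟶ C` along a variable `v`. -/
def branch {A C : Ctx P} {B : A → Ctx P} (v : of P PUnit ⟶ A) (f : sigma B ⟶ C) :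
    B (fn v PUnit.unit) ⟶ C :=
  ofEquiv (B := sigma fun i => B (fn v i))
    ⟨fun b => ⟨PUnit.unit, b⟩, fun x => x.2, fun _ => rfl, fun _ => rfl⟩ ≫ reindex v B ≫ f

/-- The map `(a, b, d) ↦ g (f (a, b), d)`. -/
def nest {A C E : Ctx P} {B : A → Ctx P} {D : C → Ctx P} (f : sigma B ⟶ C) (g : sigma D ⟶ E) :
    sigma (fun a => sigma fun b : B a => D (fn f ⟨a, b⟩)) ⟶ E :=
  ofEquiv (B := sigma fun x => D (fn f x)) (Equiv.sigmaAssoc fun a b => D (fn f ⟨a, b⟩)).symm ≫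
    reindex f D ≫ g

/-- The map `a ↦ f (a, v a)`. -/
def select {A C : Ctx P} {B : A → Ctx P} (f : sigma B ⟶ C) (v : ∀ a, of P PUnit ⟶ B a) : A ⟶ C :=
  ofEquiv (B := sigma fun _ => of P PUnit) (Equiv.sigmaPUnit A).symm ≫ sigmaMap v ≫ f

theorem sigmaMap_id {A : Ctx P} (B : A → Ctx P) : sigmaMap (fun a => 𝟙 (B a)) = 𝟙 (sigma B) :=
  hom_ext fun _ => rfl

end Ctx

namespace Tensor

variable {X Y Z : PSh.{u} P}

/-- The element `[x, [f, t]]` of `(X ⋄ Y) C`. -/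
def el {A C : Ctx P} {B : A → Ctx P} (x : X.obj A) (f : Ctx.sigma B ⟶ C) (t : ∀ a, Y.obj (B a)) :
    Tensor X Y C := mk x (Subst.mk f t)

/-- The move of the outer coend. Together with `el_sigmaMap`, the move of the inner coend, it
generates all identifications of representatives. -/
theorem el_map {A A' C : Ctx P} {B : A' → Ctx P} (j : A ⟶ A') (x : X.obj A)
    (f : Ctx.sigma B ⟶ C) (t : ∀ a, Y.obj (B a)) :
    el (X.map j x) f t = el x (Ctx.reindex j B ≫ f) fun a => t (Ctx.fn j a) :=
  mk_eq j x (Subst.mk f t)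

theorem el_sigmaMap {A C : Ctx P} {B B' : A → Ctx P} (x : X.obj A) (j : ∀ a, B a ⟶ B' a)
    (f : Ctx.sigma B' ⟶ C) (t : ∀ a, Y.obj (B a)) :
    el (Y := Y) x (Ctx.sigmaMap j ≫ f) t = el x f fun a => Y.map (j a) (t a) :=
  congrArg (mk x) (Subst.mk_eq j f t)

theorem el_ind {C : Ctx P} {p : Tensor X Y C → Prop}
    (h : ∀ (A : Ctx P) (x : X.obj A) (B : A → Ctx P) (f : Ctx.sigma B ⟶ C)
      (t : ∀ a, Y.obj (B a)), p (el x f t)) (s : Tensor X Y C) : p s := by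
  induction s using Tensor.ind with
  | h A x γ =>
    induction γ using Subst.ind with
    | h B f t => exact h A x B f t

/-- A function on representatives that is compatible with the defining relations of
`(X ⋄ Y) C`. -/
structure Cocone (X Y : PSh.{u} P) (C : Ctx P) (W : Sort*) where
  toFun : ∀ {A : Ctx P} (_ : X.obj A) {B : A → Ctx P} (_ : Ctx.sigma B ⟶ C)
    (_ : ∀ a, Y.obj (B a)), W
  map_left : ∀ {A A' : Ctx P} (j : A ⟶ A') (x : X.obj A) {B : A' → Ctx P} (f : Ctx.sigma B ⟶ C)
    (t : ∀ a, Y.obj (B a)),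
    toFun (X.map j x) f t = toFun x (Ctx.reindex j B ≫ f) fun a => t (Ctx.fn j a)
  map_right : ∀ {A : Ctx P} (x : X.obj A) {B B' : A → Ctx P} (j : ∀ a, B a ⟶ B' a)
    (f : Ctx.sigma B' ⟶ C) (t : ∀ a, Y.obj (B a)),
    toFun x (Ctx.sigmaMap j ≫ f) t = toFun x f fun a => Y.map (j a) (t a)

/-- The function on `(X ⋄ Y) C` induced by a compatible function on representatives. -/
def Cocone.desc {C : Ctx P} {W : Sort*} (c : Cocone X Y C W) : Tensor X Y C → W :=
  Quot.lift
    (fun s => Quot.lift (fun σ : SubstPre s.ctx Y C => c.toFun s.term σ.ren σ.term)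
      (by rintro _ _ ⟨j, f, t⟩; exact c.map_right _ j f t) s.subst)
    (by
      rintro _ _ ⟨j, x, γ⟩
      induction γ using Subst.ind with
      | h B f t => exact c.map_left j x f t)

theorem hom_ext {W : PSh.{u} P} {φ ψ : X ⋄ Y ⟶ W}
    (h : ∀ (A C : Ctx P) (x : X.obj A) (B : A → Ctx P) (f : Ctx.sigma B ⟶ C)
      (t : ∀ a, Y.obj (B a)), φ.app C (el x f t) = ψ.app C (el x f t)) : φ = ψ := by
  ext C s
  induction s using el_ind with
  | h A x B f t => exact h A C x B f t

end Tensor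

open Tensor

/-! ### The unitors and their inverses. -/

section Unitors

variable (X : PSh.{u} P)

/-- The left unitor on representatives: `[v, [f, t]] ↦ f (v *, -) · t (v *)`. -/
def leftUnitorCocone (C : Ctx P) : Cocone (substUnit P) X C (X.obj C) where
  toFun v _ f t := X.map (Ctx.branch v.down f) (t _)
  map_left _ _ _ _ _ := rfl
  map_right v B B' j f t := by
    have : Ctx.branch v.down (Ctx.sigmaMap j ≫ f) = j _ ≫ Ctx.branch v.down f :=
      Ctx.hom_ext fun _ => rfl
    rw [this, Functor.map_comp_apply]

/-- The left unitor `V ⋄ X ⟶ X`. -/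
def leftUnitorHom : substUnit P ⋄ X ⟶ X where
  app C := ↾(leftUnitorCocone X C).desc
  naturality C D g := by
    ext s
    induction s using el_ind with
    | h A v B f t => exact Functor.map_comp_apply X (Ctx.branch v.down f) g (t _)

/-- The map `x ↦ [id, [id, x]]`. -/
def leftUnitorInv (C : Ctx P) (x : X.obj C) : (substUnit P ⋄ X).obj C :=
  el (B := fun _ => C) (substUnit.var (𝟙 (Ctx.of P PUnit)))
    (Ctx.ofEquiv (A := Ctx.sigma fun _ => C) (Equiv.uniqueSigma fun _ : PUnit => C)) fun _ => x

instance : IsIso (leftUnitorHom X) := by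
  rw [NatTrans.isIso_iff_isIso_app]
  intro C
  rw [isIso_iff_bijective, Function.bijective_iff_has_inverse]
  refine ⟨leftUnitorInv X C, fun s => ?_, fun x => ?_⟩
  · induction s using el_ind with
    | h A v B f t =>
      -- Yoneda: `v` is the image of the identity of `1`. Moving it across the outer coend shrinks
      -- the context to `1`; an inner move along the restriction of `f` to `v` finishes.
      have hv : v = (substUnit P).map v.down (substUnit.var (𝟙 _)) := rfl
      conv_rhs => rw [hv, el_map]
      exact (el_sigmaMap (X := substUnit P) (Y := X) (substUnit.var (𝟙 (Ctx.of P PUnit)))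
        (fun _ => Ctx.branch v.down f) _ _).symm
  · exact Functor.map_id_apply X C x

/-- The right unitor on representatives: `[x, [f, v]] ↦ (a ↦ f (a, v a *)) · x`. -/
def rightUnitorCocone (C : Ctx P) : Cocone X (substUnit P) C (X.obj C) where
  toFun x _ f v := X.map (Ctx.select f fun a => (v a).down) x
  map_left j x _ f v := (Functor.map_comp_apply X j (Ctx.select f fun a => (v a).down) x).symm
  map_right _ _ _ _ _ _ := rfl

/-- The right unitor `X ⋄ V ⟶ X`. -/
def rightUnitorHom : X ⋄ substUnit P ⟶ X where
  app C := ↾(rightUnitorCocone X C).desc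
  naturality C D g := by
    ext s
    induction s using el_ind with
    | h A x B f v => exact Functor.map_comp_apply X (Ctx.select f fun a => (v a).down) g x

/-- The map `x ↦ [x, [id, id]]`. -/
def rightUnitorInv (C : Ctx P) (x : X.obj C) : (X ⋄ substUnit P).obj C :=
  el (B := fun _ => Ctx.of P PUnit) x
    (Ctx.ofEquiv (A := Ctx.sigma fun _ => Ctx.of P PUnit) (Equiv.sigmaPUnit C))
    fun _ => substUnit.var (𝟙 _)

instance : IsIso (rightUnitorHom X) := by
  rw [NatTrans.isIso_iff_isIso_app]
  intro C
  rw [isIso_iff_bijective, Function.bijective_iff_has_inverse]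
  refine ⟨rightUnitorInv X C, fun s => ?_, fun x => ?_⟩
  · induction s using el_ind with
    | h A x B f v =>
      refine (el_map _ x _ _).trans ?_
      exact (el_sigmaMap (X := X) (Y := substUnit P) x (fun a => (v a).down) f
        fun _ => substUnit.var (𝟙 _))
  · exact Functor.map_id_apply X C x

end Unitors

end Substitution

/-! ### Finite families of equivalence classes. -/

/-- If a function of finite families is invariant under reflexive relations `r₁` and `r₂` in all
coordinates, then it is invariant under the equivalence relation that they generate. -/
theorem eq_of_forall_eqvGen {ι : Type*} [Finite ι] {R : ι → Type*} {W : Sort*}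
    (r₁ r₂ : ∀ i, R i → R i → Prop) (h₁ : ∀ i u, r₁ i u u) (h₂ : ∀ i u, r₂ i u u)
    (F : (∀ i, R i) → W) (hF₁ : ∀ s t, (∀ i, r₁ i (s i) (t i)) → F s = F t)
    (hF₂ : ∀ s t, (∀ i, r₂ i (s i) (t i)) → F s = F t) {s t : ∀ i, R i}
    (h : ∀ i, Relation.EqvGen (fun u v => r₁ i u v ∨ r₂ i u v) (s i) (t i)) : F s = F t := by
  classical
  -- Reflexivity turns a step in one coordinate into a simultaneous step in all of them.
  have key : ∀ (r : ∀ i, R i → R i → Prop), (∀ i u, r i u u) → ∀ i (s : ∀ i, R i) u v, r i u v →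
      ∀ k, r k (Function.update s i u k) (Function.update s i v k) := by
    intro r hr i s u v h k
    obtain rfl | hk := eq_or_ne k i
    · simpa using h
    · simpa [hk] using hr k _
  have upd : ∀ i (s : ∀ i, R i) u v, Relation.EqvGen (fun u v => r₁ i u v ∨ r₂ i u v) u v →
      F (Function.update s i u) = F (Function.update s i v) := by
    intro i s u v h
    induction h with
    | rel u v h =>
      exact h.elim (fun h => hF₁ _ _ (key r₁ h₁ i s u v h)) fun h => hF₂ _ _ (key r₂ h₂ i s u v h)
    | refl u => rfl
    | symm u v _ ih => exact ih.symm
    | trans u v w _ _ ih ih' => exact ih.trans ih'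
  -- Pass from `s` to `t` one coordinate at a time; this is where finiteness of `ι` enters.
  have fin : ∀ S : Finset ι, F s = F (S.piecewise t s) := by
    intro S
    induction S using Finset.induction_on with
    | empty => simp
    | insert i S hi ih =>
      rw [ih, Finset.piecewise_insert, ← upd i _ _ _ (h i)]
      congr 1
      rw [← Finset.piecewise_eq_of_notMem S t s hi, Function.update_eq_self]
  cases nonempty_fintype ι
  simpa using fin Finset.univ

/-! ### Equality of representatives, and the associator. -/

section Substitution

variable {P : MorphismProperty FintypeCat.{0}} [IsContextual P]

open Tensor

namespace Tensor

/-- Representatives of the elements of `(X ⋄ Y) C`. -/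
structure Rep (X Y : PSh.{u} P) (C : Ctx P) : Type (u + 1) where
  ctx : Ctx P
  fam : ctx → Ctx P
  term : X.obj ctx
  ren : Ctx.sigma fam ⟶ C
  args : ∀ a, Y.obj (fam a)

namespace Rep

variable {X Y Z : PSh.{u} P} {C : Ctx P}

/-- The element of `(X ⋄ Y) C` given by a representative. -/
def toTensor (r : Rep X Y C) : Tensor X Y C := el r.term r.ren r.args

theorem exists_toTensor_eq (s : Tensor X Y C) : ∃ r : Rep X Y C, r.toTensor = s := by
  induction s using el_ind with
  | h A x B f t => exact ⟨⟨A, B, x, f, t⟩, rfl⟩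

/-- The relation `(j · x, f, t) ~ (x, f ∘ r_j, t ∘ j)`. -/
def LeftMove (r s : Rep X Y C) : Prop :=
  ∃ (A A' : Ctx P) (j : A ⟶ A') (x : X.obj A) (B : A' → Ctx P) (f : Ctx.sigma B ⟶ C)
    (t : ∀ a, Y.obj (B a)), r = ⟨A', B, X.map j x, f, t⟩ ∧
      s = ⟨A, fun a => B (Ctx.fn j a), x, Ctx.reindex j B ≫ f, fun a => t (Ctx.fn j a)⟩

/-- The relation `(x, f ∘ ∑ a, j a, t) ~ (x, f, (j a · t a)_a)`. -/
def RightMove (r s : Rep X Y C) : Prop :=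
  ∃ (A : Ctx P) (x : X.obj A) (B B' : A → Ctx P) (j : ∀ a, B a ⟶ B' a) (f : Ctx.sigma B' ⟶ C)
    (t : ∀ a, Y.obj (B a)), r = ⟨A, B, x, Ctx.sigmaMap j ≫ f, t⟩ ∧
      s = ⟨A, B', x, f, fun a => Y.map (j a) (t a)⟩

theorem LeftMove.refl (r : Rep X Y C) : LeftMove r r := by
  obtain ⟨A, B, x, f, t⟩ := r
  refine ⟨A, A, 𝟙 A, x, B, f, t, ?_, rfl⟩
  rw [Functor.map_id_apply]

theorem RightMove.refl (r : Rep X Y C) : RightMove r r := by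
  obtain ⟨A, B, x, f, t⟩ := r
  refine ⟨A, x, B, B, fun _ => 𝟙 _, f, t, ?_, ?_⟩
  · rw [Ctx.sigmaMap_id, Category.id_comp]
  · simp only [Functor.map_id_apply]

/-- `Tensor` is a quotient of pairs whose second entry is itself a class. It maps to the one-step
quotient of `Rep` by both moves, where equality means a chain of moves. -/
theorem eqvGen_of_toTensor_eq {r s : Rep X Y C} (h : r.toTensor = s.toTensor) :
    Relation.EqvGen (fun r s => LeftMove r s ∨ RightMove r s) r s := by
  let c : Cocone X Y C (Quot fun r s : Rep X Y C => LeftMove r s ∨ RightMove r s) :=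
    { toFun := fun {A} x {B} f t => Quot.mk _ ⟨A, B, x, f, t⟩
      map_left := fun j x _ f t => Quot.sound (Or.inl ⟨_, _, j, x, _, f, t, rfl, rfl⟩)
      map_right := fun x _ _ j f t => Quot.sound (Or.inr ⟨_, x, _, _, j, f, t, rfl, rfl⟩) }
  exact Quot.eqvGen_exact (congrArg c.desc h)

end Rep

end Tensor

section Associator

variable (X Y Z : PSh.{u} P)

variable {X Y} in
/-- The map `([x, [f, y]], [g, z]) ↦ [x, [h, ([y a, [id, (z (f (a, b)))_b]])_a]]`. -/
def associatorInnerCocone {C E : Ctx P} {D : C → Ctx P} (g : Ctx.sigma D ⟶ E)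
    (z : ∀ c, Z.obj (D c)) : Cocone X Y C (Tensor X (Y ⋄ Z) E) where
  toFun x _ f y := el (Y := Y ⋄ Z) x (Ctx.nest f g) fun a =>
    el (y a) (𝟙 _) fun b => z (Ctx.fn f ⟨a, b⟩)
  map_left j x B f y := el_map (Y := Y ⋄ Z) j x _ _
  map_right x B B' j f y := by
    -- An inner move along `j a` in `X ⋄ Y` becomes an inner move along the reindexings of `j a`,
    -- followed by an outer move along `j a` inside each argument in `Y ⋄ Z`.
    refine (el_sigmaMap (Y := Y ⋄ Z) x (fun a => Ctx.reindex (j a)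
      fun b => D (Ctx.fn f ⟨a, b⟩)) (Ctx.nest f g) _).trans ?_
    refine congrArg (el (Y := Y ⋄ Z) x (Ctx.nest f g)) (funext fun a => ?_)
    exact (el_map (j a) (y a) (𝟙 _) fun b => z (Ctx.fn f ⟨a, b⟩)).symm

/-- The associator on representatives. -/
def associatorCocone (E : Ctx P) : Cocone (X ⋄ Y) Z E (Tensor X (Y ⋄ Z) E) where
  toFun s _ g z := (associatorInnerCocone Z g z).desc s
  map_left j s D g z := by
    induction s using el_ind with
    | h A x B f y => rfl
  map_right s D D' j g z := by
    induction s using el_ind with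
    | h A x B f y =>
      refine (el_sigmaMap (Y := Y ⋄ Z) x (fun a => Ctx.sigmaMap fun b => j (Ctx.fn f ⟨a, b⟩))
        (Ctx.nest f g) _).trans ?_
      refine congrArg (el (Y := Y ⋄ Z) x (Ctx.nest f g)) (funext fun a => ?_)
      exact el_sigmaMap (y a) (fun b => j (Ctx.fn f ⟨a, b⟩)) (𝟙 _) _

/-- The associator `(X ⋄ Y) ⋄ Z ⟶ X ⋄ (Y ⋄ Z)`. -/
def associatorHom : (X ⋄ Y) ⋄ Z ⟶ X ⋄ (Y ⋄ Z) where
  app E := ↾(associatorCocone X Y Z E).desc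
  naturality E E' k := by
    ext s
    induction s using el_ind with
    | h C s D g z =>
      induction s using el_ind with
      | h A x B f y => rfl

namespace Ctx

/-- The map `((a, b), d) ↦ h (a, f a (b, d))`. -/
def unnest {A E : Ctx P} {B C : A → Ctx P} {D : ∀ a, B a → Ctx P} (f : ∀ a, sigma (D a) ⟶ C a)
    (h : sigma C ⟶ E) : sigma (A := sigma B) (fun x => D x.1 x.2) ⟶ E :=
  ofEquiv (B := sigma fun a => sigma (D a)) (Equiv.sigmaAssoc fun a (b : B a) => D a b) ≫
    sigmaMap f ≫ h

end Ctx

variable {X Y Z}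

/-- The element `[[x, [id, (y a)_a]], [h', (z a b)_(a, b)]]` for
`[x, [h, ([y a, [f a, (z a b)_b]])_a]]`. -/
def associatorInvRep {A E : Ctx P} {C : A → Ctx P} (x : X.obj A) (h : Ctx.sigma C ⟶ E)
    (r : ∀ a, Rep Y Z (C a)) : Tensor (X ⋄ Y) Z E :=
  el (X := X ⋄ Y) (A := Ctx.sigma fun a => (r a).ctx) (el x (𝟙 _) fun a => (r a).term)
    (Ctx.unnest (fun a => (r a).ren) h) fun y => (r y.1).args y.2

/-- Outer moves along all `j a` amount to one outer move along their sum, because `[x, [id, (j a · y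
a)_a]]` is the image of `[x, [id, y]]` under `Ctx.sigmaMap j`. Inner moves in all coordinates form
one inner move indexed by the pairs `(a, b)`. -/
theorem associatorInvRep_congr {A E : Ctx P} {C : A → Ctx P} (x : X.obj A) (h : Ctx.sigma C ⟶ E)
    {r s : ∀ a, Rep Y Z (C a)} (hrs : ∀ a, (r a).toTensor = (s a).toTensor) :
    associatorInvRep x h r = associatorInvRep x h s := by
  refine eq_of_forall_eqvGen (fun _ => Rep.LeftMove) (fun _ => Rep.RightMove)
    (fun _ => Rep.LeftMove.refl) (fun _ => Rep.RightMove.refl) (associatorInvRep x h) ?_ ?_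
    fun a => Rep.eqvGen_of_toTensor_eq (hrs a)
  · intro r s hrs
    choose B B' j y D f z hr hs using hrs
    obtain rfl : r = _ := funext hr
    obtain rfl : s = _ := funext hs
    refine Eq.trans ?_ (el_map (X := X ⋄ Y) (Ctx.sigmaMap j) (el x (𝟙 _) y)
      (Ctx.unnest f h) fun y => z y.1 y.2)
    exact congrArg (fun w => el (X := X ⋄ Y) w (Ctx.unnest f h) fun y => z y.1 y.2)
      (el_sigmaMap x j (𝟙 _) y).symm
  · intro r s hrs
    choose B y D D' j f z hr hs using hrs
    obtain rfl : r = _ := funext hr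
    obtain rfl : s = _ := funext hs
    exact el_sigmaMap (X := X ⋄ Y) (A := Ctx.sigma B) (el x (𝟙 _) y) (fun b => j b.1 b.2)
      (Ctx.unnest f h) fun b => z b.1 b.2

/-- An outer move along `j` in the inner tensor produces a reindexing map, which a second outer move
carries over to the outer arguments. -/
theorem associatorInvRep_map {A A' E : Ctx P} (j : A ⟶ A') {C : A' → Ctx P} (x : X.obj A)
    (h : Ctx.sigma C ⟶ E) (r : ∀ a, Rep Y Z (C a)) :
    associatorInvRep (X.map j x) h r =
      associatorInvRep x (Ctx.reindex j C ≫ h) fun a => r (Ctx.fn j a) := by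
  refine Eq.trans ?_ (el_map (X := X ⋄ Y)
    (Ctx.reindex j fun a => (r a).ctx) (el x (𝟙 _) fun a => (r (Ctx.fn j a)).term)
    (Ctx.unnest (fun a => (r a).ren) h) fun y => (r y.1).args y.2)
  exact congrArg (fun w => el (X := X ⋄ Y) (A := Ctx.sigma fun a => (r a).ctx) w
    (Ctx.unnest (fun a => (r a).ren) h) fun y => (r y.1).args y.2)
    (el_map j x (𝟙 _) fun a => (r a).term)

/-- The inverse of the associator on representatives. -/
noncomputable def associatorInvCocone (X Y Z : PSh.{u} P) (E : Ctx P) :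
    Cocone X (Y ⋄ Z) E (Tensor (X ⋄ Y) Z E) where
  toFun x _ h t := associatorInvRep x h fun a => (Rep.exists_toTensor_eq (t a)).choose
  map_left j x C h t := associatorInvRep_map j x h _
  map_right x C C' j h t := by
    -- The chosen representatives are not natural in the context. But the one chosen for `t a`,
    -- pushed along `j a`, represents the same element as the one chosen for `j a · t a`.
    refine Eq.trans ?_ (associatorInvRep_congr x h
      (r := fun a => { (Rep.exists_toTensor_eq (t a)).choose with
        ren := (Rep.exists_toTensor_eq (t a)).choose.ren ≫ j a }) fun a => ?_)
    · rfl
    · refine Eq.trans ?_ (Rep.exists_toTensor_eq ((Y ⋄ Z).map (j a) (t a))).choose_spec.symm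
      exact congrArg ((Y ⋄ Z).map (j a)) (Rep.exists_toTensor_eq (t a)).choose_spec

/-- Eliminates the chosen representatives from computations: any others may be used instead. -/
theorem associatorInvCocone_desc {A E : Ctx P} {C : A → Ctx P} (x : X.obj A)
    (h : Ctx.sigma C ⟶ E) (r : ∀ a, Rep Y Z (C a)) :
    (associatorInvCocone X Y Z E).desc (el (Y := Y ⋄ Z) x h fun a => (r a).toTensor) =
      associatorInvRep x h r :=
  associatorInvRep_congr x h fun a => (Rep.exists_toTensor_eq (r a).toTensor).choose_spec

/-- One composite is undone by an outer move along `f`, since `f · [x, [id, y]] = [x, [f, y]]`; the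
other by an inner move along the renamings of the representatives. -/
instance (X Y Z : PSh.{u} P) : IsIso (associatorHom X Y Z) := by
  rw [NatTrans.isIso_iff_isIso_app]
  intro E
  rw [isIso_iff_bijective, Function.bijective_iff_has_inverse]
  refine ⟨(associatorInvCocone X Y Z E).desc, fun s => ?_, fun s => ?_⟩
  · induction s using el_ind with
    | h C s D g z =>
      induction s using el_ind with
      | h A x B f y =>
        refine (associatorInvCocone_desc x (Ctx.nest f g) fun a =>
          ⟨B a, _, y a, 𝟙 _, fun b => z (Ctx.fn f ⟨a, b⟩)⟩).trans ?_
        exact (el_map (X := X ⋄ Y) f (el x (𝟙 _) y) g z).symm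
  · induction s using el_ind with
    | h A x C h t =>
      choose r hr using fun a => Rep.exists_toTensor_eq (t a)
      obtain rfl : (fun a => (r a).toTensor) = t := funext hr
      refine (congrArg ((associatorHom X Y Z).app E) (associatorInvCocone_desc x h r)).trans ?_
      exact el_sigmaMap (Y := Y ⋄ Z) x (fun a => (r a).ren) h fun a =>
        el (r a).term (𝟙 _) (r a).args

end Associator

end Substitution

/-! ### Monoidal axioms and right closure. -/

section Substitution

variable {P : MorphismProperty FintypeCat.{0}} [IsContextual P]

open Tensor

theorem Tensor.hom_ext₃ {X Y Z W : PSh.{u} P} {φ ψ : (X ⋄ Y) ⋄ Z ⟶ W}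
    (h : ∀ (A C E : Ctx P) (x : X.obj A) (B : A → Ctx P) (f : Ctx.sigma B ⟶ C)
      (y : ∀ a, Y.obj (B a)) (D : C → Ctx P) (g : Ctx.sigma D ⟶ E) (z : ∀ c, Z.obj (D c)),
      φ.app E (el (X := X ⋄ Y) (el x f y) g z) = ψ.app E (el (X := X ⋄ Y) (el x f y) g z)) :
    φ = ψ := by
  refine Tensor.hom_ext fun C E s D g z => ?_
  induction s using el_ind with
  | h A x B f y => exact h A C E x B f y D g z

theorem associatorHom_naturality {X X' Y Y' Z Z' : PSh.{u} P} (φ : X ⟶ X') (ψ : Y ⟶ Y')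
    (ζ : Z ⟶ Z') :
    ((substTensor P).map (((substTensor P).map φ).app Y ≫ ((substTensor P).obj X').map ψ)).app Z ≫
        ((substTensor P).obj (X' ⋄ Y')).map ζ ≫ associatorHom X' Y' Z' =
      associatorHom X Y Z ≫ ((substTensor P).map φ).app (Y ⋄ Z) ≫
        ((substTensor P).obj X').map
          (((substTensor P).map ψ).app Z ≫ ((substTensor P).obj Y').map ζ) :=
  Tensor.hom_ext₃ fun _ _ _ _ _ _ _ _ _ _ => rfl

/-- The two composites differ only in how the sum over `b` and `d` is bracketed inside each
argument; an inner move along these reassociations identifies them. -/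
theorem associatorHom_pentagon (X Y Z W : PSh.{u} P) :
    ((substTensor P).map (associatorHom X Y Z)).app W ≫ associatorHom X (Y ⋄ Z) W ≫
        ((substTensor P).obj X).map (associatorHom Y Z W) =
      associatorHom (X ⋄ Y) Z W ≫ associatorHom X Y (Z ⋄ W) := by
  refine Tensor.hom_ext fun E G s F k w => ?_
  induction s using el_ind with
  | h C s D g z =>
    induction s using el_ind with
    | h A x B f y =>
      exact (el_sigmaMap (Y := Y ⋄ (Z ⋄ W)) x
        (B := fun a => Ctx.sigma fun b : B a => Ctx.sigma fun d : D (Ctx.fn f ⟨a, b⟩) =>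
          F (Ctx.fn g ⟨Ctx.fn f ⟨a, b⟩, d⟩))
        (fun a => Ctx.nest (D := fun b => F (Ctx.fn (Ctx.nest f g) ⟨a, b⟩))
          (𝟙 (Ctx.sigma fun b : B a => D (Ctx.fn f ⟨a, b⟩))) (𝟙 _))
        (Ctx.nest (Ctx.nest f g) k) fun a =>
          el (Y := Z ⋄ W) (y a) (𝟙 _) fun b => el (z (Ctx.fn f ⟨a, b⟩)) (𝟙 _) fun d =>
            w (Ctx.fn g ⟨Ctx.fn f ⟨a, b⟩, d⟩)).symm

/-- An inner move on one side and an outer move on the other lead to the same representative, with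
renaming `(a, d) ↦ g (f (a, v a), d)`. -/
theorem associatorHom_triangle (X Y : PSh.{u} P) :
    associatorHom X (substUnit P) Y ≫ ((substTensor P).obj X).map (leftUnitorHom Y) =
      ((substTensor P).map (rightUnitorHom X)).app Y := by
  refine Tensor.hom_ext₃ fun A C E x B f v D g y => ?_
  refine Eq.trans ?_ (el_map (Ctx.select f fun a => (v a).down) x g y).symm
  exact (el_sigmaMap x (fun a => Ctx.branch (B := fun b => D (Ctx.fn f ⟨a, b⟩)) (v a).down (𝟙 _))
    (Ctx.nest f g) fun a => y (Ctx.fn f ⟨a, Ctx.fn (v a).down PUnit.unit⟩)).symm.trans rfl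

/-- The monoidal category of presheaves with the substitution tensor. -/
@[reducible]
noncomputable def substMonoidal (P : MorphismProperty FintypeCat.{0}) [IsContextual P] :
    MonoidalCategory (PSh.{u} P) where
  toMonoidalCategoryStruct := substMonoidalStruct (fun X Y Z => asIso (associatorHom X Y Z))
    (fun X => asIso (leftUnitorHom X)) fun X => asIso (rightUnitorHom X)
  tensorHom_def _ _ := rfl
  id_tensorHom_id _ _ := Tensor.hom_ext fun _ _ _ _ _ _ => rfl
  tensorHom_comp_tensorHom _ _ _ _ := Tensor.hom_ext fun _ _ _ _ _ _ => rfl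
  whiskerLeft_id X Y := ((substTensor P).obj X).map_id Y
  id_whiskerRight _ _ := Tensor.hom_ext fun _ _ _ _ _ _ => rfl
  associator_naturality φ ψ ζ := associatorHom_naturality φ ψ ζ
  leftUnitor_naturality φ := Tensor.hom_ext fun _ _ v _ f t =>
    (NatTrans.naturality_apply φ (Ctx.branch v.down f) (t _)).symm
  rightUnitor_naturality φ := Tensor.hom_ext fun _ _ x _ f v =>
    (NatTrans.naturality_apply φ (Ctx.select f fun a => (v a).down) x).symm
  pentagon X Y Z W := associatorHom_pentagon X Y Z W
  triangle X Y := associatorHom_triangle X Y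

/-- Currying `φ : X ⋄ Y ⟶ Z` to `X ⟶ (Y ⊸ Z)`, `x ↦ (γ ↦ φ [x, γ])`. -/
def substCurry {X Y Z : PSh.{u} P} (φ : X ⋄ Y ⟶ Z) : X ⟶ (substHom Y).obj Z where
  app A := ↾fun x =>
    { app C := ↾fun γ => φ.app C (Tensor.mk x γ)
      naturality C D g := by
        ext γ
        exact NatTrans.naturality_apply φ g (Tensor.mk x γ) }
  -- Naturality in the context is precisely the outer coend relation; uncurrying uses the converse.
  naturality A A' j := by
    ext x
    refine NatTrans.ext (funext fun C => ?_)
    ext γ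
    exact congrArg (φ.app C) (Tensor.mk_eq j x γ)

/-- Uncurrying `θ : X ⟶ (Y ⊸ Z)` to `X ⋄ Y ⟶ Z`, `[x, γ] ↦ θ x γ`. -/
def substUncurry {X Y Z : PSh.{u} P} (θ : X ⟶ (substHom Y).obj Z) : X ⋄ Y ⟶ Z where
  app C := ↾(Quot.lift (fun s => NatTrans.app (θ.app s.ctx s.term) C s.subst) (by
    rintro _ _ ⟨j, x, γ⟩
    exact congrArg (fun η : substPSh _ Y ⟶ Z => η.app C γ) (NatTrans.naturality_apply θ j x)))
  naturality C D g := by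
    ext s
    induction s using Tensor.ind with
    | h A x γ => exact NatTrans.naturality_apply (θ.app A x : substPSh A Y ⟶ Z) g γ

/-- The adjunction `(-) ⋄ Y ⊣ Y ⊸ (-)`. -/
def substAdjunction (Y : PSh.{u} P) : (substTensor P).flip.obj Y ⊣ substHom Y :=
  Adjunction.mkOfHomEquiv
    { homEquiv _ _ :=
        { toFun φ := substCurry φ
          invFun θ := substUncurry θ
          left_inv _ := Tensor.hom_ext fun _ _ _ _ _ _ => rfl
          right_inv _ := rfl }
      homEquiv_naturality_left_symm _ _ := Tensor.hom_ext fun _ _ _ _ _ _ => rfl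
      homEquiv_naturality_right _ _ := rfl }

end Substitution

theorem mainTheorem3 :
    -- `𝔽`, `𝕀`, `𝕊` and `𝔹` are contextual
    (IsContextual ⊤ ∧
      IsContextual (MorphismProperty.injective FintypeCat.{0}) ∧
      IsContextual (MorphismProperty.surjective FintypeCat.{0}) ∧
      IsContextual (MorphismProperty.bijective FintypeCat.{0})) ∧
    ∀ (P : MorphismProperty FintypeCat.{0}) [IsContextual P],
      ∃ (α : ∀ X Y Z : PSh.{u} P, (X ⋄ Y) ⋄ Z ≅ X ⋄ (Y ⋄ Z))
        (lam : ∀ X : PSh.{u} P, substUnit P ⋄ X ≅ X)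
        (rho : ∀ X : PSh.{u} P, X ⋄ substUnit P ≅ X)
        (M : MonoidalCategory (PSh.{u} P)),
        -- `(PSh Ctx, ⋄, V, α, lam, rho)` is a monoidal category
        M.toMonoidalCategoryStruct = substMonoidalStruct α lam rho ∧
        -- the associator is the canonical one
        (∀ (X Y Z : PSh.{u} P) (A C E : Ctx P) (B : A → Ctx P) (D : C → Ctx P)
          (x : X.obj A) (f : Ctx.sigma B ⟶ C) (y : ∀ a, Y.obj (B a))
          (g : Ctx.sigma D ⟶ E) (z : ∀ c, Z.obj (D c))
          (h : Ctx.sigma (fun a => Ctx.sigma fun b : B a => D (Ctx.fn f ⟨a, b⟩)) ⟶ E),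
          (∀ a b d, Ctx.fn h ⟨a, b, d⟩ = Ctx.fn g ⟨Ctx.fn f ⟨a, b⟩, d⟩) →
          (α X Y Z).hom.app E
              (Tensor.mk (X := X ⋄ Y) (A := C) (Tensor.mk x (Subst.mk f y)) (Subst.mk g z)) =
            Tensor.mk (Y := Y ⋄ Z) x (Subst.mk (X := Y ⋄ Z) h fun a =>
              Tensor.mk (y a) (Subst.mk (𝟙 _) fun b => z (Ctx.fn f ⟨a, b⟩)))) ∧
        -- the left unitor is the canonical one
        (∀ (X : PSh.{u} P) (A C : Ctx P) (B : A → Ctx P) (v : Ctx.of P PUnit ⟶ A)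
          (f : Ctx.sigma B ⟶ C) (t : ∀ a, X.obj (B a)) (g : B (Ctx.fn v PUnit.unit) ⟶ C),
          (∀ b, Ctx.fn g b = Ctx.fn f ⟨Ctx.fn v PUnit.unit, b⟩) →
          (lam X).hom.app C (Tensor.mk (substUnit.var v) (Subst.mk f t)) =
            X.map g (t (Ctx.fn v PUnit.unit))) ∧
        -- the right unitor is the canonical one
        (∀ (X : PSh.{u} P) (A C : Ctx P) (B : A → Ctx P) (x : X.obj A)
          (f : Ctx.sigma B ⟶ C) (v : ∀ a, Ctx.of P PUnit ⟶ B a) (g : A ⟶ C),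
          (∀ a, Ctx.fn g a = Ctx.fn f ⟨a, Ctx.fn (v a) PUnit.unit⟩) →
          (rho X).hom.app C (Tensor.mk x (Subst.mk f fun a => substUnit.var (v a))) =
            X.map g x) ∧
        -- `(-) ⋄ Y` is left adjoint to `Y ⊸ (-)`, by currying
        ∀ Y : PSh.{u} P, ∃ adj : (substTensor P).flip.obj Y ⊣ substHom Y,
          ∀ (X Z : PSh.{u} P) (φ : X ⋄ Y ⟶ Z) (A C : Ctx P) (x : X.obj A)
            (γ : (substPSh A Y).obj C),
            NatTrans.app (((adj.homEquiv X Z φ).app A) x) C γ = φ.app C (Tensor.mk x γ) := by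

  refine ⟨⟨IsContextual.top, IsContextual.injective, IsContextual.surjective,
    IsContextual.bijective⟩, fun P _ => ?_⟩
  refine ⟨fun X Y Z => asIso (associatorHom X Y Z), fun X => asIso (leftUnitorHom X),
    fun X => asIso (rightUnitorHom X), substMonoidal P, rfl, ?_, ?_, ?_, ?_⟩
  · intro X Y Z A C E B D x f y g z h hh
    -- A morphism of `Ctx` is determined by its underlying map, so the prescribed values leave only
    -- this `h`.
    obtain rfl : h = Ctx.nest f g := Ctx.hom_ext fun w => hh w.1 w.2.1 w.2.2
    rfl
  · intro X A C B v f t g hg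
    obtain rfl : g = Ctx.branch v f := Ctx.hom_ext hg
    rfl
  · intro X A C B x f v g hg
    obtain rfl : g = Ctx.select f v := Ctx.hom_ext hg
    rfl
  · intro Y
    refine ⟨substAdjunction Y, fun X Z φ A C x γ => ?_⟩
    rw [substAdjunction, Adjunction.mkOfHomEquiv_homEquiv]
    rfl
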